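/- Let $d\ge 1$. Write $\widehat f(\xi)=(2\pi)^{-d/2}\int_{\mathbb R^d} e^{-ix\cdot\xi}f(x)\,dx$, and for a symbol $m:\mathbb R^{2d}\to\mathbb C$, a real phase $\phi(\eta,\xi)$ on $\mathbb R^d\times\mathbb R^d$, $\lambda\in\mathbb R$ and Schwartz functions $f,g$ put $$B_\lambda(f,g)(x)=\frac1{(2\pi)^{d/2}}\int_{\mathbb R^{2d}}e^{ix\cdot(\eta+\xi)}e^{i\lambda\phi(\eta,\xi)}m(\eta,\xi)\widehat f(\eta)\widehat g(\xi)\,d\eta\,d\xi .$$ A quadratic form $\phi$ on $\mathbb R^{2d}$ is called nondegenerate if the matrices $\operatorname{Hess}\phi$, $\nabla_\xi(\nabla_\eta-\nabla_\xi)\phi$, $(2\nabla_\eta-\nabla_\xi)(\nabla_\xi-\nabla_\eta)\phi$ and $(\nabla_\eta-2\nabla_\xi)\nabla_\xi\phi$ are all invertible. For $p,q,r\in[1,\infty]$ consider the estimate $$(\ast)\qquad \|B_\lambda(f,g)\|_{L^r}\le C\,|\lambda|^{-\frac d2\left(\frac1p+\frac1q-\frac1r\right)}\|f\|_{L^p}\|g\|_{L^q}\qquad\text{for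 all }\lambda\ne0\text{ and all Schwartz } f,g,$$ with $C$ independent of $\lambda,f,g$, and the conditions $$(\ast\ast)\qquad \frac1p+\frac1q+\frac1r\le2,\quad \frac1p+\frac1q-\frac1r\ge1,\quad \frac1p-\frac1q-\frac1r\le0,\quad \frac1p-\frac1q+\frac1r\ge0 .$$ (i) Let $p,q,r\in[1,\infty]$. If, for every symbol $m$ that is smooth away from the origin and homogeneous of degree $0$ and every nondegenerate quadratic form $\phi$, the estimate $(\ast)$ holds with some $C=C(p,q,r,\phi,m)$, then $(p,q,r)$ satisfies $(\ast\ast)$. (ii) More precisely, if $p,q,r\in[1,\infty]$ do not satisfy $(\ast\ast)$, then already for $m\equiv1$ there is a nondegenerate quadratic form $\phi$, for which the matrices $\nabla_\eta\nabla_\xi\phi$ and $\nabla_\eta(\nabla_\eta-\nabla_\xi)\phi$ are invertible as well, such that $(\ast)$ fails; in fact for every $C\ge0$ there are Schwartz functions $f,g$ with $\|B_1(f,g)\|_{L^r}>C\|f\|_{L^p}\|g\|_{L^q}$. -/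

import Mathlib

open MeasureTheory

open scoped ENNReal NNReal ContDiff

noncomputable section

namespace BilinearOsc

/-- The Euclidean space `ℝ^d`. -/
abbrev E (d : ℕ) : Type := EuclideanSpace ℝ (Fin d)

/-- The Fourier transform with the normalization
`(2π)^(-d/2) ∫ exp (-i x·ξ) f(x) dx`. -/
def fourier {d : ℕ} (f : E d → ℂ) (ξ : E d) : ℂ :=
  (((2 * Real.pi) ^ (-(d : ℝ) / 2) : ℝ) : ℂ) *
    ∫ x : E d, Complex.exp (-(Complex.I * ((inner ℝ x ξ : ℝ) : ℂ))) * f x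

/-- The bilinear oscillatory operator with symbol `m` and phase `φ` (both functions of `(η, ξ)`),
`B_lam(f,g)(x) = (2π)^(-d/2) ∫∫ e^{i x·(η+ξ)} e^{i lam φ(η,ξ)} m(η,ξ) f^(η) g^(ξ) dη dξ`. -/
def B {d : ℕ} (m : E d × E d → ℂ) (φ : E d × E d → ℝ) (lam : ℝ) (f g : E d → ℂ) (x : E d) : ℂ :=
  (((2 * Real.pi) ^ (-(d : ℝ) / 2) : ℝ) : ℂ) *
    ∫ z : E d × E d,
      Complex.exp (Complex.I * ((inner ℝ x (z.1 + z.2) : ℝ) : ℂ)) *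
        Complex.exp (Complex.I * ((lam * φ z : ℝ) : ℂ)) * m z * fourier f z.1 * fourier g z.2

/-- The real number `1/p` for `p ∈ [1,∞]`, with `1/∞ = 0`. -/
def recip (p : ℝ≥0∞) : ℝ := (p⁻¹).toReal

/-- The four inequalities on `(1/p, 1/q, 1/r)` that describe the tetrahedron. -/
def Condi (p q r : ℝ≥0∞) : Prop :=
  recip p + recip q + recip r ≤ 2 ∧
  1 ≤ recip p + recip q - recip r ∧
  recip p - recip q - recip r ≤ 0 ∧
  0 ≤ recip p - recip q + recip r

/-- The estimate
`‖B_lam(f,g)‖_r ≤ C |lam|^{-(d/2)(1/p+1/q-1/r)} ‖f‖_p ‖g‖_q`,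
with one constant `C` for all `lam ≠ 0` and all Schwartz functions `f`, `g`. -/
def ScalingEstimate {d : ℕ} (m : E d × E d → ℂ) (φ : E d × E d → ℝ) (p q r : ℝ≥0∞) : Prop :=
  ∃ C : ℝ, ∀ lam : ℝ, lam ≠ 0 → ∀ f g : SchwartzMap (E d) ℂ,
    eLpNorm (B m φ lam f g) r volume ≤
      ENNReal.ofReal (C * |lam| ^ (-((d : ℝ) / 2) * (recip p + recip q - recip r))) *
        eLpNorm f p volume * eLpNorm g q volume

/-- Symbols that are smooth away from the origin and homogeneous of degree `0`. -/
def IsZeroHomogeneousSymbol {d : ℕ} (m : E d × E d → ℂ) : Prop :=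
  ContDiffOn ℝ ∞ m {0}ᶜ ∧ ∀ t : ℝ, 0 < t → ∀ z : E d × E d, z ≠ 0 → m (t • z) = m z

/-- The `d × d` matrix `(a ∇_η + b ∇_ξ) (a' ∇_η + b' ∇_ξ) φ` at the point `z`. Its `(i,j)` entry is
`(a ∂_{η_i} + b ∂_{ξ_i}) (a' ∂_{η_j} + b' ∂_{ξ_j}) φ`, and `a ∂_{η_i} + b ∂_{ξ_i}` is the
directional derivative along `(a e_i, b e_i)`. -/
def mixedMatrix {d : ℕ} (a b a' b' : ℝ) (φ : E d × E d → ℝ) (z : E d × E d) :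
    Matrix (Fin d) (Fin d) ℝ :=
  Matrix.of fun i j =>
    lineDeriv ℝ
      (fun w => lineDeriv ℝ φ w
        (a' • EuclideanSpace.single j (1 : ℝ), b' • EuclideanSpace.single j (1 : ℝ)))
      z (a • EuclideanSpace.single i (1 : ℝ), b • EuclideanSpace.single i (1 : ℝ))

/-- The Hessian of `φ` at `z`, in the block form
`[[∇_ξ ∇_ξ φ, ∇_ξ ∇_η φ], [∇_η ∇_ξ φ, ∇_η ∇_η φ]]`. -/
def hess {d : ℕ} (φ : E d × E d → ℝ) (z : E d × E d) :
    Matrix (Fin d ⊕ Fin d) (Fin d ⊕ Fin d) ℝ :=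
  Matrix.fromBlocks (mixedMatrix 0 1 0 1 φ z) (mixedMatrix 0 1 1 0 φ z)
    (mixedMatrix 1 0 0 1 φ z) (mixedMatrix 1 0 1 0 φ z)

/-- At every point the matrices `Hess φ`, `∇_ξ (∇_η - ∇_ξ) φ`, `(2∇_η - ∇_ξ)(∇_ξ - ∇_η) φ` and
`(∇_η - 2∇_ξ) ∇_ξ φ` are invertible. -/
def NonDegenerate {d : ℕ} (φ : E d × E d → ℝ) : Prop :=
  ∀ z : E d × E d,
    (hess φ z).det ≠ 0 ∧
    (mixedMatrix 0 1 1 (-1) φ z).det ≠ 0 ∧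
    (mixedMatrix 2 (-1) (-1) 1 φ z).det ≠ 0 ∧
    (mixedMatrix 1 (-2) 0 1 φ z).det ≠ 0

/-- At every point the matrices `∇_η ∇_ξ φ` and `∇_η (∇_η - ∇_ξ) φ` are invertible. -/
def CrossNonDegenerate {d : ℕ} (φ : E d × E d → ℝ) : Prop :=
  ∀ z : E d × E d,
    (mixedMatrix 1 0 0 1 φ z).det ≠ 0 ∧ (mixedMatrix 1 0 1 (-1) φ z).det ≠ 0

end BilinearOsc

end

namespace BilinearOsc

/-! For m ≡ 1 and the phase |η|² + η·ξ + |ξ|², the operator B₁ sends Gaussians to Gaussians, so both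
sides of the estimate are explicit. With data exp(-|x|²/(2α)), exp(-|x|²/(2β)) and Δ =
(α-2i)(β-2i)+1, the output is c·exp(-κ|x|²/2), where κ = (α+β-2i)/Δ and |c| is a constant times
|αβ/Δ|^(d/2) (`B_gaussian`). The L^p norm of exp(-γ|x|²) is a constant times (Re γ)^(-d/(2p))
(`eLpNorm_gaussian`).

Suppose |αβ/Δ|, Re 1/α and Re 1/β are at least of order s^e₁, s^e₂, s^e₃, while 0 < Re κ ≤ s^e₄.
Then the quotient of norms is at least of order s^((d/2)(e₁+e₂/p+e₃/q-e₄/r)), unbounded as s → 0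
once the exponent is negative (`exists_schwartz_lt_norm_B`).

Each condition has its own family: α = β = s for the first; α = β = s+i, where Δ → 0, for the
second; (s, s+3i/2), where again Δ → 0, for the third; the swapped pair for the fourth. Part (i) is
the contrapositive with m ≡ 1. -/

/-! ### The phase and its nondegeneracy -/

/-- The bilinear form whose diagonal is `‖η‖² + ⟪η, ξ⟫ + ‖ξ‖²`. -/
noncomputable def phaseBilin (d : ℕ) : LinearMap.BilinMap ℝ (E d × E d) ℝ :=
  (innerₗ (E d)).compl₁₂ (LinearMap.fst ℝ (E d) (E d)) (LinearMap.fst ℝ (E d) (E d)) +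
    (innerₗ (E d)).compl₁₂ (LinearMap.fst ℝ (E d) (E d)) (LinearMap.snd ℝ (E d) (E d)) +
    (innerₗ (E d)).compl₁₂ (LinearMap.snd ℝ (E d) (E d)) (LinearMap.snd ℝ (E d) (E d))

/-- The quadratic form `‖η‖² + ⟪η, ξ⟫ + ‖ξ‖²`. -/
noncomputable def phase (d : ℕ) : QuadraticForm ℝ (E d × E d) :=
  LinearMap.BilinMap.toQuadraticMap (phaseBilin d)

lemma phaseBilin_apply {d : ℕ} (z w : E d × E d) :
    phaseBilin d z w = inner ℝ z.1 w.1 + inner ℝ z.1 w.2 + inner ℝ z.2 w.2 := rfl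

lemma phase_eq_bilin {d : ℕ} (z : E d × E d) : phase d z = phaseBilin d z z := rfl

lemma phase_apply {d : ℕ} (z : E d × E d) :
    phase d z = ‖z.1‖ ^ 2 + inner ℝ z.1 z.2 + ‖z.2‖ ^ 2 := by
  simp [phase_eq_bilin, phaseBilin_apply]

lemma lineDeriv_phase {d : ℕ} (w v : E d × E d) :
    lineDeriv ℝ (fun z => phase d z) w v = phaseBilin d w v + phaseBilin d v w := by
  have h : (fun t : ℝ => phase d (w + t • v)) = fun t : ℝ =>
      phaseBilin d w w + t * (phaseBilin d w v + phaseBilin d v w) + t ^ 2 * phaseBilin d v v := by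
    funext t
    simp only [phase_eq_bilin, map_add, LinearMap.add_apply, map_smul, LinearMap.smul_apply,
      smul_eq_mul]
    ring
  rw [lineDeriv, h]
  have h1 : HasDerivAt (fun t : ℝ => phaseBilin d w w +
      t * (phaseBilin d w v + phaseBilin d v w) + t ^ 2 * phaseBilin d v v)
      (1 * (phaseBilin d w v + phaseBilin d v w) +
        ((2 : ℕ) * (0 : ℝ) ^ (2 - 1)) * phaseBilin d v v) 0 :=
    (((hasDerivAt_id (0 : ℝ)).mul_const _).const_add _).add
      ((hasDerivAt_pow 2 (0 : ℝ)).mul_const _)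
  simpa using h1.deriv

lemma lineDeriv_lineDeriv_phase {d : ℕ} (z u v : E d × E d) :
    lineDeriv ℝ (fun w => lineDeriv ℝ (fun z => phase d z) w v) z u =
      phaseBilin d u v + phaseBilin d v u := by
  have h : (fun t : ℝ => lineDeriv ℝ (fun z => phase d z) (z + t • u) v) = fun t : ℝ =>
      (phaseBilin d z v + phaseBilin d v z) + t * (phaseBilin d u v + phaseBilin d v u) := by
    funext t
    rw [lineDeriv_phase]
    simp only [map_add, LinearMap.add_apply, map_smul, LinearMap.smul_apply, smul_eq_mul]
    ring
  rw [lineDeriv, h]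
  simp

lemma mixedMatrix_phase {d : ℕ} (a b a' b' : ℝ) (z : E d × E d) :
    mixedMatrix a b a' b' (fun z => phase d z) z =
      (2 * a * a' + a * b' + b * a' + 2 * b * b') • (1 : Matrix (Fin d) (Fin d) ℝ) := by
  ext i j
  rw [mixedMatrix, Matrix.of_apply, lineDeriv_lineDeriv_phase]
  by_cases h : i = j
  · subst h
    simp [phaseBilin_apply, inner_smul_left, inner_smul_right]
    ring
  · simp [phaseBilin_apply, inner_smul_left, inner_smul_right,
      EuclideanSpace.inner_single_left, h, Ne.symm h]

lemma det_smul_one_ne_zero {d : ℕ} {c : ℝ} (hc : c ≠ 0) :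
    (c • (1 : Matrix (Fin d) (Fin d) ℝ)).det ≠ 0 := by
  simp [hc]

lemma nonDegenerate_phase (d : ℕ) : NonDegenerate (fun z => phase d z) := by
  intro z
  simp only [hess, mixedMatrix_phase]
  refine ⟨?_, det_smul_one_ne_zero (by norm_num), det_smul_one_ne_zero (by norm_num),
    det_smul_one_ne_zero (by norm_num)⟩
  refine fun h0 => one_ne_zero (α := ℝ) ?_
  have hmul : ∀ a b a' b' : ℝ, Matrix.fromBlocks (a • (1 : Matrix (Fin d) (Fin d) ℝ)) (b • (1 : Matrix (Fin d) (Fin d) ℝ))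
      (b • (1 : Matrix (Fin d) (Fin d) ℝ)) (a • (1 : Matrix (Fin d) (Fin d) ℝ)) * Matrix.fromBlocks (a' • (1 : Matrix (Fin d) (Fin d) ℝ)) (b' • (1 : Matrix (Fin d) (Fin d) ℝ))
      (b' • (1 : Matrix (Fin d) (Fin d) ℝ)) (a' • (1 : Matrix (Fin d) (Fin d) ℝ)) = Matrix.fromBlocks ((a * a' + b * b') • 1) ((a * b' + b * a') • 1)
      ((a * b' + b * a') • 1) ((a * a' + b * b') • 1) := by
    intro a b a' b'
    simp only [Matrix.fromBlocks_multiply, smul_mul_smul_comm, mul_one, ← add_smul]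
    congr 2 <;> ring
  -- The Hessian is [[2,1],[1,2]] in scalar blocks, with inverse [[2/3,-1/3],[-1/3,2/3]].
  have h := congrArg Matrix.det (hmul 2 1 (2 / 3) (-1 / 3))
  norm_num [Matrix.fromBlocks_one] at h h0
  rw [h0] at h
  simp at h

lemma crossNonDegenerate_phase (d : ℕ) : CrossNonDegenerate (fun z => phase d z) := by
  intro z
  simp only [mixedMatrix_phase]
  exact ⟨det_smul_one_ne_zero (by norm_num), det_smul_one_ne_zero (by norm_num)⟩

/-! ### Complex Gaussians as Schwartz functions -/

lemma iteratedDeriv_cexp_mul_ofReal (c : ℂ) (n : ℕ) :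
    iteratedDeriv n (fun t : ℝ => Complex.exp (c * t)) =
      fun t : ℝ => c ^ n * Complex.exp (c * t) := by
  induction n with
  | zero => simp
  | succ n ih =>
    rw [iteratedDeriv_succ, ih]
    funext t
    have h : HasDerivAt (fun t : ℝ => c ^ n * Complex.exp (c * t))
        (c ^ n * (Complex.exp (c * t) * (c * 1))) t :=
      (((hasDerivAt_id t).ofReal_comp.const_mul c).cexp).const_mul _
    rw [h.deriv]
    ring

/-- Since t² ≥ (1+t)/2 - 1, the Gaussian is dominated by a simple exponential, and one term of the
exponential series absorbs the power. -/
lemma one_add_pow_mul_exp_neg_sq_le {κ : ℝ} (hκ : 0 < κ) (m : ℕ) {t : ℝ} (ht : 0 ≤ t) :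
    (1 + t) ^ m * Real.exp (-κ * t ^ 2) ≤ Real.exp κ * (m.factorial / (κ / 2) ^ m) := by
  have h1 : Real.exp (-κ * t ^ 2) ≤ Real.exp κ * Real.exp (-(κ / 2 * (1 + t))) := by
    rw [← Real.exp_add]
    apply Real.exp_le_exp.2
    nlinarith [mul_nonneg hκ.le (sq_nonneg (t - 1)), mul_nonneg hκ.le ht, mul_nonneg hκ.le (sq_nonneg t)]
  have h2 := Real.pow_div_factorial_le_exp (κ / 2 * (1 + t)) (by positivity) m
  rw [div_le_iff₀ (by positivity), mul_pow] at h2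
  have h3 : (1 + t) ^ m * Real.exp (-(κ / 2 * (1 + t))) ≤ m.factorial / (κ / 2) ^ m := by
    rw [le_div_iff₀ (by positivity), Real.exp_neg, mul_right_comm,
      ← div_eq_mul_inv, div_le_iff₀ (Real.exp_pos _)]
    linarith
  calc (1 + t) ^ m * Real.exp (-κ * t ^ 2)
      ≤ (1 + t) ^ m * (Real.exp κ * Real.exp (-(κ / 2 * (1 + t)))) := by gcongr
    _ = Real.exp κ * ((1 + t) ^ m * Real.exp (-(κ / 2 * (1 + t)))) := by ring
    _ ≤ _ := by gcongr

lemma norm_cexp_neg_mul_sq {V : Type*} [NormedAddCommGroup V] (γ : ℂ) (x : V) :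
    ‖Complex.exp (-γ * (‖x‖ : ℂ) ^ 2)‖ = Real.exp (-γ.re * ‖x‖ ^ 2) := by
  rw [Complex.norm_exp, ← Complex.ofReal_pow, Complex.re_mul_ofReal, Complex.neg_re]

/-- The Gaussian `exp (-γ ‖x‖²)`, `0 < re γ`, as a Schwartz function. -/
noncomputable def schwartzGaussian (V : Type*) [NormedAddCommGroup V] [InnerProductSpace ℝ V]
    (γ : ℂ) (hγ : 0 < γ.re) : SchwartzMap V ℂ where
  toFun x := Complex.exp (-γ * (‖x‖ : ℂ) ^ 2)
  smooth' := by
    have h : ContDiff ℝ ∞ fun x : V => ((‖x‖ ^ 2 : ℝ) : ℂ) :=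
      Complex.ofRealCLM.contDiff.comp (contDiff_norm_sq ℝ)
    simp only [Complex.ofReal_pow] at h
    exact (contDiff_const.mul h).cexp
  decay' k n := by
    have htemp := Function.hasTemperateGrowth_norm_sq V
    obtain ⟨l, C, hC, hb⟩ := htemp.norm_iteratedFDeriv_le_uniform n
    set G : ℝ := max 1 ‖γ‖ ^ n with hG
    refine ⟨n.factorial * G * (1 + C) ^ n *
      (Real.exp γ.re * ((k + l * n).factorial / (γ.re / 2) ^ (k + l * n))), fun x => ?_⟩
    have hg : ContDiff ℝ ∞ fun t : ℝ => Complex.exp (-γ * t) :=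
      (contDiff_const.mul Complex.ofRealCLM.contDiff).cexp
    -- Faà di Bruno for exp(-γt) after t = ‖x‖². The i-th derivative of ‖x‖² must be at most D^i;
    -- the factor 1 + C makes D ≥ 1, so that D ≤ D^i for i ≥ 1.
    have key := norm_iteratedFDeriv_comp_le (n := n) hg htemp.1 (by exact_mod_cast le_top) x
      (C := G * Real.exp (-γ.re * ‖x‖ ^ 2)) (D := (1 + C) * (1 + ‖x‖) ^ l) ?_ ?_
    · have hcomp : ((fun t : ℝ => Complex.exp (-γ * t)) ∘ fun x : V => ‖x‖ ^ 2) =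
          fun x : V => Complex.exp (-γ * (‖x‖ : ℂ) ^ 2) := by
        funext x; simp
      rw [hcomp] at key
      have hx : ‖x‖ ^ k ≤ (1 + ‖x‖) ^ k := by gcongr; linarith
      calc ‖x‖ ^ k * ‖iteratedFDeriv ℝ n (fun x : V => Complex.exp (-γ * (‖x‖ : ℂ) ^ 2)) x‖
          ≤ (1 + ‖x‖) ^ k * (n.factorial * (G * Real.exp (-γ.re * ‖x‖ ^ 2)) *
              ((1 + C) * (1 + ‖x‖) ^ l) ^ n) := by gcongr
        _ = n.factorial * G * (1 + C) ^ n *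
              ((1 + ‖x‖) ^ (k + l * n) * Real.exp (-γ.re * ‖x‖ ^ 2)) := by
            rw [mul_pow, ← pow_mul, pow_add]; ring
        _ ≤ _ := by
            refine mul_le_mul_of_nonneg_left ?_ (by positivity)
            exact one_add_pow_mul_exp_neg_sq_le hγ _ (norm_nonneg x)
    · intro i hi
      rw [norm_iteratedFDeriv_eq_norm_iteratedDeriv, iteratedDeriv_cexp_mul_ofReal, norm_mul,
        norm_pow, norm_neg]
      have h1 : ‖γ‖ ^ i ≤ G :=
        (pow_le_pow_left₀ (norm_nonneg _) (le_max_right _ _) i).trans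
          (pow_le_pow_right₀ (le_max_left _ _) hi)
      have h2 := norm_cexp_neg_mul_sq γ x
      push_cast
      rw [h2]
      gcongr
    · intro i hi hin
      have h1 : (1 : ℝ) ≤ (1 + ‖x‖) ^ l := one_le_pow₀ (by linarith [norm_nonneg x])
      have h2 : (1 : ℝ) ≤ (1 + C) * (1 + ‖x‖) ^ l := by nlinarith
      calc _ ≤ C * (1 + ‖x‖) ^ l := hb i hin x
        _ ≤ (1 + C) * (1 + ‖x‖) ^ l := by nlinarith
        _ ≤ _ := le_self_pow₀ h2 (by omega)

/-! ### Norms of Gaussians -/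

/-- The `L^p` norm of `exp (-‖x‖²)` on `ℝ^d`. -/
noncomputable def gaussianNorm (d : ℕ) (p : ℝ≥0∞) : ℝ :=
  (Real.pi / p.toReal) ^ ((d : ℝ) / 2 * recip p)

lemma gaussianNorm_pos {d : ℕ} {p : ℝ≥0∞} (hp : 1 ≤ p) : 0 < gaussianNorm d p := by
  unfold gaussianNorm
  by_cases h : p = ⊤
  -- Here the base is π/0 = 0 and the exponent is 0, so the value is 1, the correct sup norm.
  · simp [h, recip]
  · have : 0 < p.toReal := ENNReal.toReal_pos (by positivity) h
    positivity

lemma eLpNorm_gaussian {d : ℕ} {p : ℝ≥0∞} (hp : 1 ≤ p) {γ : ℂ} (hγ : 0 < γ.re) :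
    eLpNorm (fun x : E d => Complex.exp (-γ * (‖x‖ : ℂ) ^ 2)) p volume =
      ENNReal.ofReal (gaussianNorm d p * γ.re ^ (-((d : ℝ) / 2 * recip p))) := by
  have hp0 : p ≠ 0 := by positivity
  have hcont : Continuous fun x : E d => Complex.exp (-γ * (‖x‖ : ℂ) ^ 2) := by fun_prop
  by_cases h : p = ⊤
  · subst h
    simp only [gaussianNorm, recip, ENNReal.inv_top, ENNReal.toReal_zero, mul_zero, neg_zero,
      Real.rpow_zero, mul_one, ENNReal.ofReal_one, eLpNorm_exponent_top]
    apply le_antisymm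
    · refine eLpNormEssSup_le_of_ae_enorm_bound (Filter.Eventually.of_forall fun x => ?_)
      rw [← ofReal_norm, norm_cexp_neg_mul_sq]
      refine ENNReal.ofReal_le_one.2 (Real.exp_le_one_iff.2 ?_)
      nlinarith [sq_nonneg ‖x‖]
    -- By continuity the set where the modulus exceeds the essential supremum is open; it would
    -- contain 0, hence have positive measure.
    · by_contra! hlt
      have hae := enorm_ae_le_eLpNormEssSup
        (fun x : E d => Complex.exp (-γ * (‖x‖ : ℂ) ^ 2)) volume
      have hopen : IsOpen {x : E d | eLpNormEssSup
          (fun x : E d => Complex.exp (-γ * (‖x‖ : ℂ) ^ 2)) volume <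
            ‖Complex.exp (-γ * (‖x‖ : ℂ) ^ 2)‖ₑ} :=
        isOpen_lt continuous_const hcont.enorm
      have hne := hopen.measure_pos volume ⟨0, by simpa using hlt⟩
      refine hne.ne' ?_
      rw [ae_iff] at hae
      simpa only [not_le] using hae
  · have hpr : 0 < p.toReal := ENNReal.toReal_pos hp0 h
    rw [eLpNorm_eq_lintegral_rpow_enorm_toReal hp0 h]
    have h1 : ∀ x : E d, ‖Complex.exp (-γ * (‖x‖ : ℂ) ^ 2)‖ₑ ^ p.toReal =
        ENNReal.ofReal (Real.exp (-(γ.re * p.toReal) * ‖x‖ ^ 2)) := by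
      intro x
      rw [← ofReal_norm, norm_cexp_neg_mul_sq,
        ENNReal.ofReal_rpow_of_pos (Real.exp_pos _), ← Real.exp_mul]
      congr 2; ring
    simp_rw [h1]
    have hpos : 0 < γ.re * p.toReal := mul_pos hγ hpr
    have hI := GaussianFourier.integral_rexp_neg_mul_sq_norm (V := E d) hpos
    have hint : Integrable (fun x : E d => Real.exp (-(γ.re * p.toReal) * ‖x‖ ^ 2)) := by
      apply Integrable.of_integral_ne_zero
      rw [hI]
      positivity
    rw [← ofReal_integral_eq_lintegral_ofReal hint (.of_forall fun x => (Real.exp_pos _).le), hI,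
      finrank_euclideanSpace_fin, ENNReal.ofReal_rpow_of_pos (by positivity)]
    congr 1
    have hrec : recip p = 1 / p.toReal := by simp [recip, ENNReal.toReal_inv]
    rw [gaussianNorm, hrec, ← Real.rpow_mul (by positivity), Real.rpow_neg hγ.le,
      ← Real.inv_rpow hγ.le, ← Real.mul_rpow (by positivity) (by positivity)]
    congr 1
    field_simp

/-! ### The operator on Gaussian data -/

lemma norm_cpow_natCast_div_two (z : ℂ) (d : ℕ) : ‖z ^ ((d : ℂ) / 2)‖ = ‖z‖ ^ ((d : ℝ) / 2) := by
  rw [← Complex.norm_cpow_real]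
  push_cast
  rfl

lemma re_inv_pos {z : ℂ} (hz : 0 < z.re) : 0 < (z⁻¹).re := by
  have h : z ≠ 0 := by rintro rfl; simp at hz
  rw [Complex.inv_re]
  exact div_pos hz (Complex.normSq_pos.2 h)

lemma fourier_gaussian {d : ℕ} {γ : ℂ} (hγ : 0 < γ.re) (ξ : E d) :
    fourier (fun x : E d => Complex.exp (-γ * (‖x‖ : ℂ) ^ 2)) ξ =
      (((2 * Real.pi) ^ (-(d : ℝ) / 2) : ℝ) : ℂ) * (Real.pi / γ) ^ ((d : ℂ) / 2) *
        Complex.exp (-(1 / (4 * γ)) * (‖ξ‖ : ℂ) ^ 2) := by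
  rw [fourier, mul_assoc]
  congr 1
  have h := GaussianFourier.integral_cexp_neg_mul_sq_norm_add hγ (-Complex.I) ξ
  rw [finrank_euclideanSpace_fin] at h
  convert h using 2
  · funext x
    rw [← Complex.exp_add, real_inner_comm]
    congr 1; ring
  · congr 1
    rw [neg_sq, Complex.I_sq]
    ring

/-- The integrand of `B` for the phase `phase d` and Gaussian data. -/
noncomputable def gaussianIntegrand {d : ℕ} (α β : ℂ) (x : E d) (z : E d × E d) : ℂ :=
  Complex.exp (Complex.I * ((inner ℝ x (z.1 + z.2) : ℝ) : ℂ)) *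
    Complex.exp (Complex.I * ((phase d z : ℝ) : ℂ)) *
    (Complex.exp (-(α / 2) * (‖z.1‖ : ℂ) ^ 2) * Complex.exp (-(β / 2) * (‖z.2‖ : ℂ) ^ 2))

lemma integrable_cexp_neg_mul_sq_norm {d : ℕ} {γ : ℂ} (hγ : 0 < γ.re) :
    Integrable fun x : E d => Complex.exp (-γ * (‖x‖ : ℂ) ^ 2) := by
  simpa using GaussianFourier.integrable_cexp_neg_mul_sq_norm_add hγ 0 (0 : E d)

lemma integrable_gaussianIntegrand {d : ℕ} {α β : ℂ} (hα : 0 < α.re) (hβ : 0 < β.re) (x : E d) :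
    Integrable (gaussianIntegrand α β x) (volume.prod volume) := by
  have h1 := integrable_cexp_neg_mul_sq_norm (d := d) (γ := α / 2) (by simpa using hα)
  have h2 := integrable_cexp_neg_mul_sq_norm (d := d) (γ := β / 2) (by simpa using hβ)
  refine (h1.mul_prod h2).mono ?_ (Filter.Eventually.of_forall fun z => ?_)
  · refine Continuous.aestronglyMeasurable ?_
    unfold gaussianIntegrand
    simp only [phase_apply]
    fun_prop
  · rw [gaussianIntegrand, norm_mul, norm_mul, mul_comm Complex.I, mul_comm Complex.I,
      Complex.norm_exp_ofReal_mul_I, Complex.norm_exp_ofReal_mul_I, one_mul, one_mul]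

/-- The quadratic part is -(A/2)|η|² + iη·ξ - (D/2)|ξ|². Integrating in ξ leaves the Schur
complement A + D⁻¹ as coefficient in η; its real part is positive, so the η integral converges and
AD + 1 = (A + D⁻¹)D ≠ 0. -/
lemma integral_gaussianIntegrand {d : ℕ} {α β A D : ℂ} (hα : 0 < α.re) (hβ : 0 < β.re)
    (hA : A = α - 2 * Complex.I) (hD : D = β - 2 * Complex.I) (x : E d) :
    ∫ z, gaussianIntegrand α β x z =
      (Real.pi / (D / 2)) ^ ((d : ℂ) / 2) * (Real.pi / ((A + D⁻¹) / 2)) ^ ((d : ℂ) / 2) *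
        Complex.exp (-((A + D + 2 * Complex.I) / (2 * (A * D + 1))) * (‖x‖ : ℂ) ^ 2) := by
  have hAre : 0 < A.re := by simpa [hA] using hα
  have hDre : 0 < D.re := by simpa [hD] using hβ
  have hD0 : D ≠ 0 := by intro h; simp [h] at hDre
  have hS : 0 < (A + D⁻¹).re := by
    rw [Complex.add_re]; exact add_pos hAre (re_inv_pos hDre)
  have hS0 : A + D⁻¹ ≠ 0 := by intro h; simp [h] at hS
  have hdet : A * D + 1 ≠ 0 := by
    have : A * D + 1 = (A + D⁻¹) * D := by field_simp
    rw [this]; exact mul_ne_zero hS0 hD0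
  rw [Measure.volume_eq_prod, integral_prod _ (integrable_gaussianIntegrand hα hβ x)]
  have hinner : ∀ η : E d, ∫ ξ : E d, gaussianIntegrand α β x (η, ξ) =
      (Real.pi / (D / 2)) ^ ((d : ℂ) / 2) * Complex.exp (-(1 / (2 * D)) * (‖x‖ : ℂ) ^ 2) *
        Complex.exp (-((A + D⁻¹) / 2) * (‖η‖ : ℂ) ^ 2 +
          (Complex.I - D⁻¹) * ((inner ℝ x η : ℝ) : ℂ)) := by
    intro η
    have h := GaussianFourier.integral_cexp_neg_mul_sq_norm_add (b := D / 2) (by simpa using hDre)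
      Complex.I (x + η)
    rw [finrank_euclideanSpace_fin] at h
    have hint : ∀ ξ : E d, gaussianIntegrand α β x (η, ξ) =
        Complex.exp (-(A / 2) * (‖η‖ : ℂ) ^ 2 + Complex.I * ((inner ℝ x η : ℝ) : ℂ)) *
          Complex.exp (-(D / 2) * (‖ξ‖ : ℂ) ^ 2 +
            Complex.I * ((inner ℝ (x + η) ξ : ℝ) : ℂ)) := by
      intro ξ
      simp only [gaussianIntegrand, phase_apply, ← Complex.exp_add]
      congr 1
      simp only [inner_add_left, inner_add_right, hA, hD]
      push_cast
      ring
    simp_rw [hint]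
    rw [integral_const_mul, h, mul_left_comm, mul_assoc]
    congr 1
    rw [← Complex.exp_add, ← Complex.exp_add]
    congr 1
    have hn : ((‖x + η‖ : ℝ) : ℂ) ^ 2 =
        (‖x‖ : ℂ) ^ 2 + 2 * ((inner ℝ x η : ℝ) : ℂ) + (‖η‖ : ℂ) ^ 2 := by
      exact_mod_cast norm_add_sq_real x η
    rw [hn, Complex.I_sq]
    field_simp
    ring
  simp_rw [hinner]
  have h := GaussianFourier.integral_cexp_neg_mul_sq_norm_add (b := (A + D⁻¹) / 2)
    (by simpa using hS) (Complex.I - D⁻¹) x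
  rw [finrank_euclideanSpace_fin] at h
  rw [integral_const_mul, h, mul_mul_mul_comm, ← Complex.exp_add]
  congr 2
  have hk : (Complex.I - D⁻¹) ^ 2 / (4 * ((A + D⁻¹) / 2)) =
      1 / (2 * D) - (A + D + 2 * Complex.I) / (2 * (A * D + 1)) := by
    have hS1 : A + D⁻¹ = (A * D + 1) / D := by field_simp
    have hdet' : D * A + 1 ≠ 0 := by rwa [mul_comm]
    rw [hS1]
    field_simp
    linear_combination (4 * D ^ 2) * Complex.I_sq
  rw [mul_div_right_comm, hk]
  ring

/-- Only the modulus of c is recorded: it is all that the norms see, and it avoids choosing branches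
when merging complex powers. -/
lemma B_gaussian {d : ℕ} {α β : ℂ} (hα : 0 < α.re) (hβ : 0 < β.re) :
    ∃ c : ℂ, ‖c‖ = (2 * Real.pi) ^ ((d : ℝ) / 2) * (‖α‖ * ‖β‖ /
        ‖(α - 2 * Complex.I) * (β - 2 * Complex.I) + 1‖) ^ ((d : ℝ) / 2) ∧
      B (fun _ => 1) (fun z => phase d z) 1
        (fun x => Complex.exp (-(2 * α)⁻¹ * (‖x‖ : ℂ) ^ 2))
        (fun x => Complex.exp (-(2 * β)⁻¹ * (‖x‖ : ℂ) ^ 2)) =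
      c • fun x => Complex.exp (-((α + β - 2 * Complex.I) /
        (2 * ((α - 2 * Complex.I) * (β - 2 * Complex.I) + 1))) * (‖x‖ : ℂ) ^ 2) := by
  have hα0 : α ≠ 0 := by rintro rfl; simp at hα
  have hβ0 : β ≠ 0 := by rintro rfl; simp at hβ
  set A := α - 2 * Complex.I with hA
  set D := β - 2 * Complex.I with hD
  have hDre : 0 < D.re := by simpa [hD] using hβ
  have hD0 : D ≠ 0 := by intro h; simp [h] at hDre
  have hα' : 0 < ((2 * α)⁻¹).re := re_inv_pos (by simpa using hα)
  have hβ' : 0 < ((2 * β)⁻¹).re := re_inv_pos (by simpa using hβ)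
  set P : ℂ := (((2 * Real.pi) ^ (-(d : ℝ) / 2) : ℝ) : ℂ) with hP
  refine ⟨P * (P * (Real.pi / (2 * α)⁻¹) ^ ((d : ℂ) / 2)) *
    (P * (Real.pi / (2 * β)⁻¹) ^ ((d : ℂ) / 2)) * ((Real.pi / (D / 2)) ^ ((d : ℂ) / 2) *
      (Real.pi / ((A + D⁻¹) / 2)) ^ ((d : ℂ) / 2)), ?_, ?_⟩
  · have hPn : ‖P‖ = (2 * Real.pi)⁻¹ ^ ((d : ℝ) / 2) := by
      rw [hP, Complex.norm_real, Real.norm_of_nonneg (by positivity), neg_div,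
        Real.rpow_neg (by positivity), Real.inv_rpow (by positivity)]
    simp only [norm_mul, norm_cpow_natCast_div_two, hPn]
    repeat rw [← Real.mul_rpow (by positivity) (by positivity)]
    congr 1
    have hS1 : A + D⁻¹ = (A * D + 1) / D := by field_simp
    simp only [hS1, norm_div, norm_inv, norm_mul, Complex.norm_real,
      Real.norm_of_nonneg Real.pi_pos.le, Complex.norm_ofNat]
    have h1 := norm_ne_zero_iff.2 hD0
    have h2 := Real.pi_ne_zero
    field_simp
  · funext x
    rw [B, Pi.smul_apply, smul_eq_mul]
    have hint : ∀ z : E d × E d,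
        Complex.exp (Complex.I * ((inner ℝ x (z.1 + z.2) : ℝ) : ℂ)) *
          Complex.exp (Complex.I * ((1 * phase d z : ℝ) : ℂ)) * 1 *
          fourier (fun x : E d => Complex.exp (-(2 * α)⁻¹ * (‖x‖ : ℂ) ^ 2)) z.1 *
          fourier (fun x : E d => Complex.exp (-(2 * β)⁻¹ * (‖x‖ : ℂ) ^ 2)) z.2 =
        (P * (Real.pi / (2 * α)⁻¹) ^ ((d : ℂ) / 2)) *
          (P * (Real.pi / (2 * β)⁻¹) ^ ((d : ℂ) / 2)) * gaussianIntegrand α β x z := by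
      intro z
      rw [fourier_gaussian hα', fourier_gaussian hβ', gaussianIntegrand]
      have e1 : 1 / (4 * (2 * α)⁻¹) = α / 2 := by field_simp; norm_num
      have e2 : 1 / (4 * (2 * β)⁻¹) = β / 2 := by field_simp; norm_num
      rw [e1, e2, one_mul]
      ring
    simp_rw [hint]
    rw [integral_const_mul, integral_gaussianIntegrand hα hβ hA hD]
    have e3 : A + D + 2 * Complex.I = α + β - 2 * Complex.I := by rw [hA, hD]; ring
    rw [e3]
    ring

/-! ### Blow-up along a family of Gaussians -/

lemma recip_nonneg (p : ℝ≥0∞) : 0 ≤ recip p := ENNReal.toReal_nonneg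

lemma norm_schwartzGaussian_le {d : ℕ} {p : ℝ≥0∞} (hp : 1 ≤ p) {α : ℂ} (hα : 0 < ((2 * α)⁻¹).re)
    {t : ℝ} (ht : 0 < t) (h : t / 4 ≤ (α⁻¹).re) :
    eLpNorm (schwartzGaussian (E d) _ hα) p volume ≤
      ENNReal.ofReal (gaussianNorm d p * (1 / 8) ^ (-((d : ℝ) / 2 * recip p)) *
        t ^ (-((d : ℝ) / 2 * recip p))) := by
  have h1 : t * (1 / 8) ≤ ((2 * α)⁻¹).re := by
    have : ((2 * α)⁻¹).re = (α⁻¹).re / 2 := by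
      rw [mul_inv, mul_comm, ← div_eq_mul_inv, Complex.div_ofNat_re]
    rw [this]; linarith
  have h2 := eLpNorm_gaussian (d := d) hp hα
  refine (le_of_eq h2).trans (ENNReal.ofReal_le_ofReal ?_)
  rw [mul_assoc, ← Real.mul_rpow (by norm_num) ht.le, mul_comm (1 / 8 : ℝ)]
  refine mul_le_mul_of_nonneg_left ?_ (gaussianNorm_pos hp).le
  refine Real.rpow_le_rpow_of_nonpos (by positivity) h1 ?_
  have := recip_nonneg p
  rw [neg_nonpos]
  positivity

lemma le_norm_B_gaussian {d : ℕ} {r : ℝ≥0∞} (hr : 1 ≤ r) {α β : ℂ} (hα : 0 < α.re)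
    (hβ : 0 < β.re) {t u : ℝ} (ht : 0 < t) (hu : 0 < u)
    (hρ : t / 8 ≤ ‖α‖ * ‖β‖ / ‖(α - 2 * Complex.I) * (β - 2 * Complex.I) + 1‖)
    (hκ : 0 < ((α + β - 2 * Complex.I) /
      ((α - 2 * Complex.I) * (β - 2 * Complex.I) + 1)).re)
    (hκu : ((α + β - 2 * Complex.I) /
      ((α - 2 * Complex.I) * (β - 2 * Complex.I) + 1)).re ≤ u) :
    ENNReal.ofReal ((2 * Real.pi) ^ ((d : ℝ) / 2) * (1 / 8) ^ ((d : ℝ) / 2) * gaussianNorm d r *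
        (t ^ ((d : ℝ) / 2) * u ^ (-((d : ℝ) / 2 * recip r)))) ≤
      eLpNorm (B (fun _ => 1) (fun z => phase d z) 1
        (fun x => Complex.exp (-(2 * α)⁻¹ * (‖x‖ : ℂ) ^ 2))
        (fun x => Complex.exp (-(2 * β)⁻¹ * (‖x‖ : ℂ) ^ 2))) r volume := by
  obtain ⟨c, hc, hB⟩ := B_gaussian (d := d) hα hβ
  set k := (α + β - 2 * Complex.I) / ((α - 2 * Complex.I) * (β - 2 * Complex.I) + 1) with hk
  have hk2 : (α + β - 2 * Complex.I) / (2 * ((α - 2 * Complex.I) * (β - 2 * Complex.I) + 1)) =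
      k / 2 := by
    rw [hk, div_div, mul_comm (2 : ℂ) (_ + 1)]
  have hkre : (k / 2).re = k.re / 2 := Complex.div_ofNat_re k 2
  have hkpos : 0 < (k / 2).re := by rw [hkre]; linarith
  have hR : 0 ≤ (d : ℝ) / 2 * recip r := mul_nonneg (by positivity) (recip_nonneg r)
  rw [hB, hk2, eLpNorm_const_smul, eLpNorm_gaussian hr hkpos, ← ofReal_norm, hc,
    ← ENNReal.ofReal_mul (by positivity)]
  refine ENNReal.ofReal_le_ofReal ?_
  have hg := gaussianNorm_pos (d := d) hr
  have h1 : (t * (1 / 8)) ^ ((d : ℝ) / 2) ≤ (‖α‖ * ‖β‖ /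
      ‖(α - 2 * Complex.I) * (β - 2 * Complex.I) + 1‖) ^ ((d : ℝ) / 2) :=
    Real.rpow_le_rpow (by positivity) (by linarith) (by positivity)
  have h2 : u ^ (-((d : ℝ) / 2 * recip r)) ≤ (k / 2).re ^ (-((d : ℝ) / 2 * recip r)) :=
    Real.rpow_le_rpow_of_nonpos hkpos (by rw [hkre]; linarith) (by linarith)
  calc _ = (2 * Real.pi) ^ ((d : ℝ) / 2) * (t * (1 / 8)) ^ ((d : ℝ) / 2) *
        (gaussianNorm d r * u ^ (-((d : ℝ) / 2 * recip r))) := by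
        rw [Real.mul_rpow ht.le (by norm_num)]; ring
    _ ≤ _ := by gcongr

/-- The `L^p × L^q → L^r` bound fails at `lam = 1` as soon as a one-parameter family of Gaussians
violates it in the limit `s → 0`. -/
lemma exists_schwartz_lt_norm_B {d : ℕ} (hd : 1 ≤ d) {p q r : ℝ≥0∞} (hp : 1 ≤ p) (hq : 1 ≤ q)
    (hr : 1 ≤ r) (α β : ℝ → ℂ) (e₁ e₂ e₃ e₄ : ℝ)
    (hα : ∀ s, 0 < s → s < 1 → 0 < (α s).re) (hβ : ∀ s, 0 < s → s < 1 → 0 < (β s).re)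
    (hα' : ∀ s, 0 < s → s < 1 → s ^ e₂ / 4 ≤ ((α s)⁻¹).re)
    (hβ' : ∀ s, 0 < s → s < 1 → s ^ e₃ / 4 ≤ ((β s)⁻¹).re)
    (hρ : ∀ s, 0 < s → s < 1 → s ^ e₁ / 8 ≤
      ‖α s‖ * ‖β s‖ / ‖(α s - 2 * Complex.I) * (β s - 2 * Complex.I) + 1‖)
    (hκ : ∀ s, 0 < s → s < 1 → ((α s + β s - 2 * Complex.I) /
      ((α s - 2 * Complex.I) * (β s - 2 * Complex.I) + 1)).re ∈ Set.Ioc 0 (s ^ e₄))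
    (hneg : e₁ + e₂ * recip p + e₃ * recip q - e₄ * recip r < 0) (C : ℝ≥0) :
    ∃ f g : SchwartzMap (E d) ℂ, C * eLpNorm f p volume * eLpNorm g q volume <
      eLpNorm (B (fun _ => 1) (fun z => phase d z) 1 f g) r volume := by
  have hd0 : (0 : ℝ) < d / 2 := by
    have : (1 : ℝ) ≤ d := by exact_mod_cast hd
    positivity
  set h : ℝ := (d : ℝ) / 2 with hh
  set a : ℝ := (2 * Real.pi) ^ h * (1 / 8) ^ h * gaussianNorm d r with ha
  set b : ℝ := gaussianNorm d p * (1 / 8) ^ (-(h * recip p)) with hb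
  set c : ℝ := gaussianNorm d q * (1 / 8) ^ (-(h * recip q)) with hc
  have hgp := gaussianNorm_pos (d := d) hp
  have hgq := gaussianNorm_pos (d := d) hq
  have hgr := gaussianNorm_pos (d := d) hr
  have ha0 : 0 < a := by positivity
  have hb0 : 0 < b := by positivity
  have hc0 : 0 < c := by positivity
  set e := h * (e₁ + e₂ * recip p + e₃ * recip q - e₄ * recip r) with he
  have he0 : e < 0 := mul_neg_of_pos_of_neg hd0 hneg
  -- Since e < 0, s^e tends to infinity as s → 0⁺ and beats every fixed constant.
  obtain ⟨s, hs0, hs1, hs⟩ : ∃ s : ℝ, 0 < s ∧ s < 1 ∧ C * b * c / a < s ^ e := by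
    have h1 := (tendsto_rpow_neg_nhdsGT_zero he0).eventually_gt_atTop (C * b * c / a)
    have h2 : ∀ᶠ s : ℝ in nhdsWithin 0 (Set.Ioi 0), s ∈ Set.Ioo (0 : ℝ) 1 :=
      Ioo_mem_nhdsGT one_pos
    obtain ⟨s, hs⟩ := (h1.and h2).exists
    exact ⟨s, hs.2.1, hs.2.2, hs.1⟩
  have hα2 : 0 < ((2 * α s)⁻¹).re := re_inv_pos (by simpa using hα s hs0 hs1)
  have hβ2 : 0 < ((2 * β s)⁻¹).re := re_inv_pos (by simpa using hβ s hs0 hs1)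
  refine ⟨schwartzGaussian (E d) _ hα2, schwartzGaussian (E d) _ hβ2, ?_⟩
  have hf := norm_schwartzGaussian_le (d := d) hp hα2 (Real.rpow_pos_of_pos hs0 e₂) (hα' s hs0 hs1)
  have hg := norm_schwartzGaussian_le (d := d) hq hβ2 (Real.rpow_pos_of_pos hs0 e₃) (hβ' s hs0 hs1)
  have hB := le_norm_B_gaussian (d := d) hr (hα s hs0 hs1) (hβ s hs0 hs1)
    (Real.rpow_pos_of_pos hs0 e₁) (Real.rpow_pos_of_pos hs0 e₄) (hρ s hs0 hs1) (hκ s hs0 hs1).1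
    (hκ s hs0 hs1).2
  rw [← hh] at hf hg hB
  refine lt_of_le_of_lt (mul_le_mul' (mul_le_mul' le_rfl hf) hg) (lt_of_lt_of_le ?_ hB)
  rw [← ENNReal.ofReal_coe_nnreal, ← ENNReal.ofReal_mul C.coe_nonneg, ← ENNReal.ofReal_mul (by positivity),
    ENNReal.ofReal_lt_ofReal_iff (by positivity), ← ha, ← hb, ← hc]
  rw [div_lt_iff₀ ha0] at hs
  simp only [← Real.rpow_mul hs0.le, ← Real.rpow_add hs0]
  have hs' : e + (e₂ * (-(h * recip p)) + e₃ * (-(h * recip q))) =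
      e₁ * h + e₄ * (-(h * recip r)) := by rw [he]; ring
  calc C * (b * s ^ (e₂ * (-(h * recip p)))) * (c * s ^ (e₃ * (-(h * recip q))))
      = C * b * c * s ^ (e₂ * (-(h * recip p)) + e₃ * (-(h * recip q))) := by
        rw [Real.rpow_add hs0]; ring
    _ < s ^ e * a * s ^ (e₂ * (-(h * recip p)) + e₃ * (-(h * recip q))) :=
        mul_lt_mul_of_pos_right hs (Real.rpow_pos_of_pos hs0 _)
    _ = a * s ^ (e₁ * h + e₄ * (-(h * recip r))) := by
        rw [← hs', Real.rpow_add hs0 e]; ring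

/-! ### The three families -/

lemma re_div_eq {w z : ℂ} {x y : ℝ} (hz : z ≠ 0) (h : w = ⟨x, y⟩ * z) : (w / z).re = x := by
  rw [(div_eq_iff hz).2 h]

section Families

variable {s : ℝ}

lemma inv_re_ofReal : ((s : ℂ)⁻¹).re = s⁻¹ := by
  rw [← Complex.ofReal_inv, Complex.ofReal_re]

lemma inv_re_add_mul_I (y : ℝ) : (((s : ℂ) + y * Complex.I)⁻¹).re = s / (s ^ 2 + y ^ 2) := by
  simp [Complex.inv_re, Complex.normSq_apply, sq]

lemma le_norm_div_real_family (hs0 : 0 < s) (hs1 : s < 1) :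
    s ^ 2 / 8 ≤ ‖(s : ℂ)‖ * ‖(s : ℂ)‖ /
      ‖((s : ℂ) - 2 * Complex.I) * ((s : ℂ) - 2 * Complex.I) + 1‖ := by
  have hz : ((s : ℂ) - 2 * Complex.I) * ((s : ℂ) - 2 * Complex.I) + 1 =
      ⟨s ^ 2 - 3, -4 * s⟩ := by
    apply Complex.ext <;> simp <;> ring
  have hne : (⟨s ^ 2 - 3, -4 * s⟩ : ℂ) ≠ 0 := fun h => by
    have := congrArg Complex.im h; simp at this; linarith
  rw [hz, Complex.norm_real, Real.norm_of_nonneg hs0.le, ← sq]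
  refine div_le_div_of_nonneg_left (by positivity) (norm_pos_iff.2 hne)
    ((Complex.norm_le_abs_re_add_abs_im _).trans ?_)
  rw [abs_of_nonpos (by simp only; nlinarith), abs_of_nonpos (by simp only; linarith)]
  simp only
  nlinarith

lemma re_div_real_family (hs0 : 0 < s) :
    (((s : ℂ) + s - 2 * Complex.I) /
      (((s : ℂ) - 2 * Complex.I) * ((s : ℂ) - 2 * Complex.I) + 1)).re ∈ Set.Ioc 0 s := by
  -- Δ = (s-i)(s-3i), so the quotient is 2/(s-3i).
  rw [re_div_eq (x := 2 * s / (s ^ 2 + 9)) (y := 6 / (s ^ 2 + 9))]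
  · refine ⟨by positivity, ?_⟩
    rw [div_le_iff₀ (by positivity)]
    nlinarith [pow_pos hs0 3]
  · intro h
    have := congrArg Complex.im h; simp at this; linarith
  · apply Complex.ext <;> simp <;> field_simp <;> ring

lemma le_norm_div_chirp_family (hs0 : 0 < s) (hs1 : s < 1) :
    s⁻¹ / 8 ≤ ‖(s : ℂ) + (1 : ℝ) * Complex.I‖ * ‖(s : ℂ) + (1 : ℝ) * Complex.I‖ /
      ‖((s : ℂ) + (1 : ℝ) * Complex.I - 2 * Complex.I) *
        ((s : ℂ) + (1 : ℝ) * Complex.I - 2 * Complex.I) + 1‖ := by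
  have hz : ((s : ℂ) + (1 : ℝ) * Complex.I - 2 * Complex.I) *
      ((s : ℂ) + (1 : ℝ) * Complex.I - 2 * Complex.I) + 1 = ⟨s ^ 2, -2 * s⟩ := by
    apply Complex.ext <;> simp <;> ring
  have hne : (⟨s ^ 2, -2 * s⟩ : ℂ) ≠ 0 := fun h => by
    have := congrArg Complex.im h; simp at this; linarith
  have h1 : 1 ≤ ‖(s : ℂ) + (1 : ℝ) * Complex.I‖ := by
    simpa using Complex.abs_im_le_norm ((s : ℂ) + (1 : ℝ) * Complex.I)
  have h2 : ‖(⟨s ^ 2, -2 * s⟩ : ℂ)‖ ≤ 8 * s := by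
    refine (Complex.norm_le_abs_re_add_abs_im _).trans ?_
    rw [abs_of_nonneg (by simp only; positivity), abs_of_nonpos (by simp only; linarith)]
    simp only
    nlinarith
  rw [hz, le_div_iff₀ (norm_pos_iff.2 hne)]
  calc s⁻¹ / 8 * ‖(⟨s ^ 2, -2 * s⟩ : ℂ)‖ ≤ s⁻¹ / 8 * (8 * s) := by gcongr
    _ = 1 := by field_simp
    _ ≤ _ := by nlinarith

lemma re_div_chirp_family (hs0 : 0 < s) :
    (((s : ℂ) + (1 : ℝ) * Complex.I + ((s : ℂ) + (1 : ℝ) * Complex.I) - 2 * Complex.I) /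
      (((s : ℂ) + (1 : ℝ) * Complex.I - 2 * Complex.I) *
        ((s : ℂ) + (1 : ℝ) * Complex.I - 2 * Complex.I) + 1)).re ∈ Set.Ioc 0 s := by
  -- Δ = s(s-2i) and the numerator is 2s, so the quotient is 2/(s-2i).
  rw [re_div_eq (x := 2 * s / (s ^ 2 + 4)) (y := 4 / (s ^ 2 + 4))]
  · refine ⟨by positivity, ?_⟩
    rw [div_le_iff₀ (by positivity)]
    nlinarith [pow_pos hs0 3]
  · intro h
    have := congrArg Complex.im h; simp at this; linarith
  · apply Complex.ext <;> simp <;> field_simp <;> ring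

/-- The shift 3/2 is chosen so that (-2i)(3i/2-2i) = -1: then Δ = s(s-5i/2) vanishes to first order,
matching |α| = s. -/
lemma le_norm_div_mixed_family (hs0 : 0 < s) (hs1 : s < 1) :
    1 / 8 ≤ ‖(s : ℂ)‖ * ‖(s : ℂ) + (3 / 2 : ℝ) * Complex.I‖ /
      ‖((s : ℂ) - 2 * Complex.I) *
        ((s : ℂ) + (3 / 2 : ℝ) * Complex.I - 2 * Complex.I) + 1‖ := by
  have hz : ((s : ℂ) - 2 * Complex.I) * ((s : ℂ) + (3 / 2 : ℝ) * Complex.I - 2 * Complex.I) + 1 =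
      ⟨s ^ 2, -(5 / 2) * s⟩ := by
    apply Complex.ext <;> simp <;> ring
  have hne : (⟨s ^ 2, -(5 / 2) * s⟩ : ℂ) ≠ 0 := fun h => by
    have := congrArg Complex.im h; simp at this; linarith
  have h1 : 3 / 2 ≤ ‖(s : ℂ) + (3 / 2 : ℝ) * Complex.I‖ := by
    refine le_trans (le_of_eq ?_) (Complex.abs_im_le_norm ((s : ℂ) + (3 / 2 : ℝ) * Complex.I))
    norm_num [abs_of_pos]
  have h2 : ‖(⟨s ^ 2, -(5 / 2) * s⟩ : ℂ)‖ ≤ 8 * s := by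
    refine (Complex.norm_le_abs_re_add_abs_im _).trans ?_
    rw [abs_of_nonneg (by simp only; positivity), abs_of_nonpos (by simp only; linarith)]
    simp only
    nlinarith
  rw [hz, le_div_iff₀ (norm_pos_iff.2 hne), Complex.norm_real, Real.norm_of_nonneg hs0.le]
  nlinarith

lemma re_div_mixed_family (hs0 : 0 < s) (hs1 : s < 1) :
    (((s : ℂ) + ((s : ℂ) + (3 / 2 : ℝ) * Complex.I) - 2 * Complex.I) /
      (((s : ℂ) - 2 * Complex.I) *
        ((s : ℂ) + (3 / 2 : ℝ) * Complex.I - 2 * Complex.I) + 1)).re ∈ Set.Ioc 0 s⁻¹ := by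
  rw [re_div_eq (x := (2 * s ^ 2 + 5 / 4) / (s * (s ^ 2 + 25 / 4))) (y := 9 / 2 / (s ^ 2 + 25 / 4))]
  · refine ⟨by positivity, ?_⟩
    rw [inv_eq_one_div, div_le_div_iff₀ (by positivity) hs0]
    nlinarith [pow_pos hs0 3]
  · intro h
    have := congrArg Complex.im h; simp at this; linarith
  · apply Complex.ext <;> simp <;> field_simp <;> ring

lemma div_four_le_inv_re (hs0 : 0 < s) (hs1 : s < 1) {y : ℝ} (hy : y ^ 2 ≤ 3) :
    s / 4 ≤ (((s : ℂ) + y * Complex.I)⁻¹).re := by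
  rw [inv_re_add_mul_I]
  -- The 4 bounds s² + y², as s < 1 and y² ≤ 3.
  exact div_le_div_of_nonneg_left hs0.le (by positivity) (by nlinarith)

lemma inv_div_four_le_inv_re (hs0 : 0 < s) : s⁻¹ / 4 ≤ ((s : ℂ)⁻¹).re := by
  rw [inv_re_ofReal]
  linarith [inv_pos.2 hs0]

end Families

/-! ### One family for each violated inequality -/

lemma exists_schwartz_lt_norm_B_of_not_condi {d : ℕ} (hd : 1 ≤ d) {p q r : ℝ≥0∞} (hp : 1 ≤ p)
    (hq : 1 ≤ q) (hr : 1 ≤ r) (hcond : ¬ Condi p q r) (C : ℝ≥0) :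
    ∃ f g : SchwartzMap (E d) ℂ, C * eLpNorm f p volume * eLpNorm g q volume <
      eLpNorm (B (fun _ => 1) (fun z => phase d z) 1 f g) r volume := by
  have hy : ((3 / 2 : ℝ)) ^ 2 ≤ 3 := by norm_num
  by_cases h1 : recip p + recip q + recip r ≤ 2
  swap
  · refine exists_schwartz_lt_norm_B hd hp hq hr (fun s => s) (fun s => s) 2 (-1) (-1) 1
      (fun s h0 _ => h0) (fun s h0 _ => h0) (fun s h0 _ => ?_) (fun s h0 _ => ?_)
      (fun s h0 h1 => ?_) (fun s h0 _ => ?_) (by linarith) C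
    · simpa only [Real.rpow_neg_one] using inv_div_four_le_inv_re h0
    · simpa only [Real.rpow_neg_one] using inv_div_four_le_inv_re h0
    · simpa only [Real.rpow_two] using le_norm_div_real_family h0 h1
    · simpa only [Real.rpow_one] using re_div_real_family h0
  by_cases h2 : 1 ≤ recip p + recip q - recip r
  swap
  · refine exists_schwartz_lt_norm_B hd hp hq hr (fun s => s + (1 : ℝ) * Complex.I)
      (fun s => s + (1 : ℝ) * Complex.I) (-1) 1 1 1
      (fun s h0 _ => by simpa using h0) (fun s h0 _ => by simpa using h0) (fun s h0 h1 => ?_)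
      (fun s h0 h1 => ?_) (fun s h0 h1 => ?_) (fun s h0 h1 => ?_) (by linarith) C
    · simpa only [Real.rpow_one] using div_four_le_inv_re h0 h1 (by norm_num)
    · simpa only [Real.rpow_one] using div_four_le_inv_re h0 h1 (by norm_num)
    · simpa only [Real.rpow_neg_one] using le_norm_div_chirp_family h0 h1
    · simpa only [Real.rpow_one] using re_div_chirp_family h0
  by_cases h3 : recip p - recip q - recip r ≤ 0
  swap
  · refine exists_schwartz_lt_norm_B hd hp hq hr (fun s => s)
      (fun s => s + (3 / 2 : ℝ) * Complex.I) 0 (-1) 1 (-1)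
      (fun s h0 _ => h0) (fun s h0 _ => by simpa using h0) (fun s h0 _ => ?_)
      (fun s h0 h1 => ?_) (fun s h0 h1 => ?_) (fun s h0 h1 => ?_) (by linarith) C
    · simpa only [Real.rpow_neg_one] using inv_div_four_le_inv_re h0
    · simpa only [Real.rpow_one] using div_four_le_inv_re h0 h1 hy
    · simpa only [Real.rpow_zero] using le_norm_div_mixed_family h0 h1
    · simpa only [Real.rpow_neg_one] using re_div_mixed_family h0 h1
  have h4 : ¬ 0 ≤ recip p - recip q + recip r := fun h4 => hcond ⟨h1, h2, h3, h4⟩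
  -- The previous family with α and β exchanged; Δ and κ are symmetric in them.
  refine exists_schwartz_lt_norm_B hd hp hq hr (fun s => s + (3 / 2 : ℝ) * Complex.I)
    (fun s => s) 0 1 (-1) (-1)
    (fun s h0 _ => by simpa using h0) (fun s h0 _ => h0) (fun s h0 h1 => ?_)
    (fun s h0 h1 => ?_) (fun s h0 h1 => ?_) (fun s h0 h1 => ?_) (by linarith) C
  · simpa only [Real.rpow_one] using div_four_le_inv_re h0 h1 hy
  · simpa only [Real.rpow_neg_one] using inv_div_four_le_inv_re h0
  · rw [mul_comm, mul_comm (_ - _) ((s : ℂ) - _), Real.rpow_zero]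
    exact le_norm_div_mixed_family h0 h1
  · rw [mul_comm (_ - _) ((s : ℂ) - _), add_comm _ (s : ℂ), Real.rpow_neg_one]
    exact re_div_mixed_family h0 h1

lemma isZeroHomogeneousSymbol_one (d : ℕ) :
    IsZeroHomogeneousSymbol (fun _ : E d × E d => (1 : ℂ)) :=
  ⟨contDiffOn_const, fun _ _ _ _ => rfl⟩

lemma not_scalingEstimate_of_forall_exists_lt {d : ℕ} {m : E d × E d → ℂ} {φ : E d × E d → ℝ}
    {p q r : ℝ≥0∞} (h : ∀ C : ℝ≥0, ∃ f g : SchwartzMap (E d) ℂ,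
      C * eLpNorm f p volume * eLpNorm g q volume < eLpNorm (B m φ 1 f g) r volume) :
    ¬ ScalingEstimate m φ p q r := by
  rintro ⟨C, hC⟩
  obtain ⟨f, g, hfg⟩ := h C.toNNReal
  refine hfg.not_ge ((hC 1 one_ne_zero f g).trans (le_of_eq ?_))
  -- At λ = 1 the power of |λ| is 1, whatever its exponent.
  simp [ENNReal.ofReal]

end BilinearOsc

theorem mainTheorem9 (d : ℕ) (hd : 1 ≤ d) (p q r : ℝ≥0∞)
    (hp : 1 ≤ p) (hq : 1 ≤ q) (hr : 1 ≤ r) :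
    ((∀ (m : BilinearOsc.E d × BilinearOsc.E d → ℂ)
        (φ : QuadraticForm ℝ (BilinearOsc.E d × BilinearOsc.E d)),
        BilinearOsc.IsZeroHomogeneousSymbol m → BilinearOsc.NonDegenerate (fun z => φ z) →
          BilinearOsc.ScalingEstimate m (fun z => φ z) p q r) →
      BilinearOsc.Condi p q r) ∧
    (¬ BilinearOsc.Condi p q r →
      ∃ φ : QuadraticForm ℝ (BilinearOsc.E d × BilinearOsc.E d),
        BilinearOsc.NonDegenerate (fun z => φ z) ∧
        BilinearOsc.CrossNonDegenerate (fun z => φ z) ∧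
        ¬ BilinearOsc.ScalingEstimate (fun _ => 1) (fun z => φ z) p q r ∧
        ∀ C : ℝ≥0, ∃ f g : SchwartzMap (BilinearOsc.E d) ℂ,
          C * eLpNorm f p volume * eLpNorm g q volume <
            eLpNorm (BilinearOsc.B (fun _ => 1) (fun z => φ z) 1 f g) r volume) := by
  have key := fun h : ¬ BilinearOsc.Condi p q r =>
    BilinearOsc.exists_schwartz_lt_norm_B_of_not_condi hd hp hq hr h
  refine ⟨fun h => ?_, fun h => ⟨BilinearOsc.phase d, BilinearOsc.nonDegenerate_phase d,
    BilinearOsc.crossNonDegenerate_phase d,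
    BilinearOsc.not_scalingEstimate_of_forall_exists_lt (key h), key h⟩⟩
  by_contra hn
  exact BilinearOsc.not_scalingEstimate_of_forall_exists_lt (key hn)
    (h _ (BilinearOsc.phase d) (BilinearOsc.isZeroHomogeneousSymbol_one d)
      (BilinearOsc.nonDegenerate_phase d))
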